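/- Let $q\ge 5$ be a prime power and let $$\mu=\begin{cases}\frac{q^2-3q+2}{6} & \text{if } q\not\equiv 0 \pmod 3,\\[2pt] \frac{q^2-3q}{6} & \text{if } q\equiv 0\pmod 3,\end{cases}$$ which is an integer. Let $\mathscr C=\{(t^3:t^2:t:1) : t\in\mathbb F_q\}\cup\{(1:0:0:0)\}\subset \mathrm{PG}(3,q)$ be the twisted cubic. A set $S$ of points of $\mathrm{PG}(N,q)$ is called $(\rho,\mu)$-saturating if (M1) $S$ generates $\mathrm{PG}(N,q)$; (M2) some point lies in no $(\rho-1)$-dimensional subspace generated by points of $S$; (M3) every such point lies in at least $\mu$ of the $\rho$-dimensional subspaces generated by points of $S$. A $(\rho,\mu)$-saturating $n$-set is minimal if it contains no $(\rho,\mu)$-saturating $(n-1)$-set. An $[n,k,d]_qR$ code is a linear code over $\mathbb F_q$ of length $n$, dimension $k$, minimum distance $d$ and covering radius $R$. It is quasi-perfect if $R=\lfloor (d-1)/2\rfloor+1$, and it is an $(R,\mu)$ multiple covering of the farthest-off points ($(R,\mu)$-MCF code) if every vector $x\in\mathbb F_q^n$ at distance $R$ from the code is at distance exactly $R$ from at least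 $\mu$ codewords. If $d\ge 2R-1$, the $\mu$-density of such a code $C$ is $$\gamma_\mu(C,R,q)=\frac{\binom nR (q-1)^R-\binom{2R-1}{R-1}A_{2R-1}(C)}{\mu\left(q^{n-k}-\sum_{i=0}^{R-1}\binom ni (q-1)^i\right)},$$ where $A_w(C)$ is the number of codewords of weight $w$. A sequence of MCF codes over fields of size $q\to\infty$ is asymptotically optimal if its $\mu$-densities tend to $1$. A code associated with $\mathscr C$ is a code of length $q+1$ having a parity-check matrix whose columns are homogeneous coordinates of the points of $\mathscr C$, each point occurring exactly once. A generalized doubly-extended Reed–Solomon (GDRS) code of length $q+1$ and redundancy $r$ is a code with a parity-check matrix whose columns are, in some order, nonzero multiples of the vectors $(1,\alpha,\dots,\alpha^{r-1})$, $\alpha\in\mathbb F_q$, and of $(0,\dots,0,1)$. Then the following hold. (i) $\mathscr C$ has $q+1$ points and is a minimal $(2,\mu)$-saturating set in $\mathrm{PG}(3,q)$. (ii) Codes associated with $\mathscr C$ exist, and every such code $C$ is a GDRS code of redundancy $4$ with parameters $[q+1,q-3,5]_q3$, is quasi-perfect, is a $(3,\mu)$-MCF code, and satisfies $\gamma_\mu(C,3,q)>1$.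 (iii) For every sequence of prime powers $q\ge5$ with $q\to\infty$ and associated codes $C$, one has $\gamma_\mu(C,3,q)\to 1$; thus these codes form an asymptotically optimal collection of MCF codes. -/

import Mathlib

open Filter Topology
open scoped LinearAlgebra.Projectivization

noncomputable section

namespace TwistedCubicCode

/-! ### Saturating sets in projective spaces -/

section Saturating

variable {K V : Type*} [DivisionRing K] [AddCommGroup V] [Module K V]

/-- The projective subspaces generated by points of `S` whose underlying vector space has
dimension `m`, that is, the generated subspaces of projective dimension `m - 1`. -/
def generatedSubspaces (S : Set (ℙ K V)) (m : ℕ) : Set (Projectivization.Subspace K V) :=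
  {W | Module.finrank K (Projectivization.Subspace.submodule W) = m ∧
    ∃ T ⊆ S, Projectivization.Subspace.span T = W}

/-- `(ρ, μ)`-saturating sets of points:
(M1) `S` generates the whole space;
(M2) some point lies on no subspace of projective dimension `ρ - 1` generated by points of `S`;
(M3) each such point lies on at least `μ` subspaces of projective dimension `ρ` generated by
points of `S`. -/
structure IsSaturating (ρ μ : ℕ) (S : Set (ℙ K V)) : Prop where
  generates : Projectivization.Subspace.span S = ⊤
  exists_uncovered : ∃ Q : ℙ K V, ∀ W ∈ generatedSubspaces S ρ, Q ∉ W
  le_count : ∀ Q : ℙ K V, (∀ W ∈ generatedSubspaces S ρ, Q ∉ W) →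
    μ ≤ {W ∈ generatedSubspaces S (ρ + 1) | Q ∈ W}.ncard

/-- A `(ρ, μ)`-saturating `n`-set is minimal if it contains no `(ρ, μ)`-saturating
`(n - 1)`-set. -/
def IsMinimalSaturating (ρ μ : ℕ) (S : Set (ℙ K V)) : Prop :=
  IsSaturating ρ μ S ∧ ∀ T ⊆ S, T.ncard + 1 = S.ncard → ¬ IsSaturating ρ μ T

end Saturating

/-! ### Linear codes -/

section Codes

variable {F ι : Type*} [Field F] [Fintype ι]

open Classical in
/-- The Hamming distance `d(x, C)` from a vector to a linear code. -/
def distToCode (x : ι → F) (C : Submodule F (ι → F)) : ℕ :=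
  sInf {w | ∃ c ∈ C, hammingDist x c = w}

open Classical in
/-- `d` is the minimum distance of `C`. -/
def HasMinDist (C : Submodule F (ι → F)) (d : ℕ) : Prop :=
  IsLeast {w | ∃ c ∈ C, ∃ c' ∈ C, c ≠ c' ∧ hammingDist c c' = w} d

/-- `R` is the covering radius of `C`: the largest distance from a vector to `C`. -/
def HasCoveringRadius (C : Submodule F (ι → F)) (R : ℕ) : Prop :=
  IsGreatest (Set.range fun x : ι → F => distToCode x C) R

/-- `C` is an `[n, k, d]_q R` code, where `q` is the size of the field `F`. -/
structure HasParameters (C : Submodule F (ι → F)) (n k d R : ℕ) : Prop where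
  length : Fintype.card ι = n
  dimension : Module.finrank F C = k
  minDist : HasMinDist C d
  coveringRadius : HasCoveringRadius C R

/-- `C` is quasi-perfect: its covering radius is its packing radius `⌊(d - 1) / 2⌋` plus one. -/
def IsQuasiPerfect (C : Submodule F (ι → F)) : Prop :=
  ∃ d R, HasMinDist C d ∧ HasCoveringRadius C R ∧ R = (d - 1) / 2 + 1

open Classical in
/-- `C` is an `(R, μ)` multiple covering of the farthest-off points: `C` has covering radius `R`
and every vector at distance `R` from `C` is at distance `R` from at least `μ` codewords. -/
def IsMCF (C : Submodule F (ι → F)) (R μ : ℕ) : Prop :=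
  HasCoveringRadius C R ∧
    ∀ x : ι → F, distToCode x C = R → μ ≤ {c : ι → F | c ∈ C ∧ hammingDist x c = R}.ncard

open Classical in
/-- `A_w(C)`, the number of codewords of Hamming weight `w`. -/
def weightCount (C : Submodule F (ι → F)) (w : ℕ) : ℕ :=
  {c : ι → F | c ∈ C ∧ hammingNorm c = w}.ncard

/-- The `μ`-density `γ_μ(C, R, q)` of an `(R, μ)`-MCF code of length `n`, dimension `k` and minimum
distance at least `2R - 1` over the field with `q` elements:
`(binom(n,R) (q-1)^R - binom(2R-1,R-1) A_{2R-1}(C)) / (μ (q^(n-k) - ∑_{i<R} binom(n,i) (q-1)^i))`. -/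
def muDensity [Fintype F] (C : Submodule F (ι → F)) (R μ : ℕ) : ℝ :=
  let n := Fintype.card ι
  let q : ℝ := Fintype.card F
  ((n.choose R : ℝ) * (q - 1) ^ R - ((2 * R - 1).choose (R - 1) : ℝ) * weightCount C (2 * R - 1)) /
    (μ * (q ^ (n - Module.finrank F C) - ∑ i ∈ Finset.range R, (n.choose i : ℝ) * (q - 1) ^ i))

/-- The linear code having the vectors `h j` as the columns of a parity-check matrix. -/
def codeOfColumns {m : ℕ} (h : ι → Fin m → F) : Submodule F (ι → F) :=
  LinearMap.ker (Matrix.mulVecLin (Matrix.of fun i j => h j i))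

/-- `C` is a code associated with the point set `S`: it admits a parity-check matrix whose columns
are homogeneous coordinates of the points of `S`, each point being used exactly once. -/
def IsAssociatedCode {m : ℕ} (C : Submodule F (ι → F)) (S : Set (ℙ F (Fin m → F))) : Prop :=
  ∃ (h : ι → Fin m → F) (h0 : ∀ j, h j ≠ 0),
    Set.BijOn (fun j => Projectivization.mk F (h j) (h0 j)) Set.univ S ∧ C = codeOfColumns h

/-- The column `(1, α, …, α^(r-1))` for `α ∈ F`, and `(0, …, 0, 1)` for `α = ∞`. -/
def rsColumn (r : ℕ) : OnePoint F → Fin r → F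
  | OnePoint.some α => fun i => α ^ (i : ℕ)
  | OnePoint.infty => fun i => if (i : ℕ) + 1 = r then 1 else 0

/-- Generalized doubly-extended Reed–Solomon codes of length `q + 1` and redundancy `r`: the columns
of a parity-check matrix are nonzero multiples of the vectors `rsColumn r α`, where `α` runs
through `F ∪ {∞}`. -/
def IsGDRS (r : ℕ) (C : Submodule F (ι → F)) : Prop :=
  ∃ (e : ι ≃ OnePoint F) (v : ι → F), (∀ j, v j ≠ 0) ∧
    C = codeOfColumns fun j => v j • rsColumn r (e j)

end Codes

/-- A sequence of codes `C i` over finite fields `F i` with `|F i| → ∞` is an asymptotically optimal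
collection of `(R, μ i)`-MCF codes if each `C i` is an `(R, μ i)`-MCF code and the `μ i`-density of
`C i` tends to `1`. -/
def IsAsymptoticallyOptimalMCF {F ι : ℕ → Type*} [∀ i, Field (F i)] [∀ i, Fintype (F i)]
    [∀ i, Fintype (ι i)] (C : ∀ i, Submodule (F i) (ι i → F i)) (R : ℕ) (μ : ℕ → ℕ) : Prop :=
  Tendsto (fun i => Fintype.card (F i)) atTop atTop ∧
    (∀ i, IsMCF (C i) R (μ i)) ∧
    Tendsto (fun i => muDensity (C i) R (μ i)) atTop (𝓝 1)

/-! ### The twisted cubic -/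

section Cubic

variable (F : Type*) [Field F]

variable {F} in
/-- Homogeneous coordinates of `P(t)`, `t ∈ F ∪ {∞}`. -/
def cubicVec : OnePoint F → Fin 4 → F
  | OnePoint.some t => ![t ^ 3, t ^ 2, t, 1]
  | OnePoint.infty => ![1, 0, 0, 0]

variable {F} in
theorem cubicVec_ne_zero (t : OnePoint F) : cubicVec t ≠ 0 := by
  induction t using OnePoint.rec with
  | infty => exact fun h => one_ne_zero (α := F) (by simpa [cubicVec] using congrFun h 0)
  | coe t => exact fun h => one_ne_zero (α := F) (by simpa [cubicVec] using congrFun h 3)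

/-- The twisted cubic `{P(t) : t ∈ F ∪ {∞}}` in `PG(3, F)`. -/
def twistedCubic : Set (ℙ F (Fin 4 → F)) :=
  Set.range fun t : OnePoint F => Projectivization.mk F (cubicVec t) (cubicVec_ne_zero t)

end Cubic

/-- `μ = (q² - 3q) / 6` if `3 ∣ q` and `μ = (q² - 3q + 2) / 6` otherwise. -/
def mu (q : ℕ) : ℕ := if 3 ∣ q then (q ^ 2 - 3 * q) / 6 else (q ^ 2 - 3 * q + 2) / 6

end TwistedCubicCode

end

/-!
Write `P(t)`, `t ∈ F ∪ {∞}`, for the points of the twisted cubic. The plane through `P(r)`, `P(s)`,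
`P(t)` has an equation `polar r s t a = 0` in the coordinates `a`, symmetric in `r`, `s`, `t` and
linear in the homogeneous coordinates of each of them; on `P(p)` it takes the value
`[p r] [p s] [p t]`, where `[p r]` is the determinant of the coordinates of `p` and `r`
(`polar_cubicVec`). Hence any four points of the cubic are linearly independent
(`linearIndepOn_cubicVec`).

Let `a` be a point on no bisecant. For `s ≠ t` the linear form `r ↦ polar r s t a` is not zero, so it
has exactly one root `r`, and if `r ≠ s, t` this gives a plane through `a` generated by three points
of the cubic, each plane arising from six pairs `(s, t)`. Of the `q (q + 1)` pairs one has to discard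
those with `polar s s t a = 0` or `polar t t s a = 0` (`card_pairs_le`). A given `s` has at
most one such `t`, unless `a` is on the tangent at `P(s)`, where every `t ≠ s` occurs; there is at most
one tangent through `a` (`OffChords.tangent_unique`). So at most `2q` pairs of each kind are lost, and
one fewer when `3 ∤ q`, because then the binary cubic `polar t t t a` of a tangent point has
a simple root besides its double root (`OffChords.exists_simple_root`). What remains is at
least `6 μ` (`mu_le_card_planesThrough`). This is the saturating property; it is minimal since a point
removed from the cubic lies on no plane generated by three of the others.

For a code with the points of the cubic as parity-check columns, the distance of a vector to the code
is the least number of columns whose span contains its syndrome. So the vectors at distance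
three are those whose syndrome is off the bisecants, and the planes through the syndrome correspond
to the codewords at distance three. The code is MDS, so its codewords of weight five number
`binom (q + 1) 5 * (q - 1)` (`InGeneralPosition.weightCount_eq`), which gives the closed form
`(q - 1) (q² + q - 4) / (6 μ (q + 1))` of the density (`muDensity_columns`). Since
`q² - 3q ≤ 6 μ ≤ q² - 3q + 2`, it lies strictly above `1` and is at most `1 + 7 / q`.
-/

namespace TwistedCubicCode

/-! ### The polar form of a point with respect to the twisted cubic -/

theorem card_onePoint (α : Type*) [Fintype α] : Fintype.card (OnePoint α) = Fintype.card α + 1 :=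
  Fintype.card_option

theorem card_of_equiv_onePoint {α ι : Type*} [Fintype α] [Fintype ι] (e : ι ≃ OnePoint α) :
    Fintype.card ι = Fintype.card α + 1 := by
  rw [Fintype.card_congr e, card_onePoint]

theorem exists_notMem_of_card_le_three {α : Type*} [Fintype α] (hα : 3 ≤ Fintype.card α)
    {T : Finset (OnePoint α)} (hT : T.card ≤ 3) : ∃ p, p ∉ T := by
  by_contra! h
  have := card_onePoint α
  rw [← Finset.card_univ, ← Finset.eq_univ_iff_forall.2 h] at this
  omega

section Polar

variable {F : Type*} [Field F]

/-- First homogeneous coordinate of a point of the projective line `F ∪ {∞}`. -/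
def homX : OnePoint F → F
  | OnePoint.some t => t
  | OnePoint.infty => 1

/-- Second homogeneous coordinate of a point of the projective line `F ∪ {∞}`. -/
def homY : OnePoint F → F
  | OnePoint.some _ => 1
  | OnePoint.infty => 0

/-- The determinant of the homogeneous coordinates of two points of the projective line. -/
def bracket (s t : OnePoint F) : F := homX s * homY t - homX t * homY s

theorem bracket_eq_zero_iff {s t : OnePoint F} : bracket s t = 0 ↔ s = t := by
  induction s using OnePoint.rec <;> induction t using OnePoint.rec <;>
    simp [bracket, homX, homY, sub_eq_zero]

theorem cubicVec_eq (t : OnePoint F) :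
    cubicVec t = ![homX t ^ 3, homX t ^ 2 * homY t, homX t * homY t ^ 2, homY t ^ 3] := by
  induction t using OnePoint.rec <;> simp [cubicVec, homX, homY]

/-- One coefficient of the linear form `r ↦ polar r s t a`: see `polar_eq`. -/
def polarA (s t : OnePoint F) (a : Fin 4 → F) : F :=
  a 0 * (homY s * homY t) - a 1 * (homX s * homY t + homX t * homY s) + a 2 * (homX s * homX t)

/-- The other coefficient of the linear form `r ↦ polar r s t a`: see `polar_eq`. -/
def polarB (s t : OnePoint F) (a : Fin 4 → F) : F :=
  a 1 * (homY s * homY t) - a 2 * (homX s * homY t + homX t * homY s) + a 3 * (homX s * homX t)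

/-- The equation, evaluated at `a`, of the plane through the points of the twisted cubic with
parameters `r`, `s`, `t`; repeated parameters give tangent and osculating planes. It is symmetric
in `r`, `s`, `t`, and for fixed `a` it is the trilinear form obtained by polarizing a binary
cubic. -/
def polar (r s t : OnePoint F) : (Fin 4 → F) →ₗ[F] F where
  toFun a := polarA s t a * homY r - polarB s t a * homX r
  map_add' a b := by simp only [polarA, polarB, Pi.add_apply]; ring
  map_smul' c a := by
    simp only [polarA, polarB, Pi.smul_apply, smul_eq_mul, RingHom.id_apply]; ring

theorem polar_eq (r s t : OnePoint F) (a : Fin 4 → F) :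
    polar r s t a = polarA s t a * homY r - polarB s t a * homX r := rfl

theorem polar_comm_left (r s t : OnePoint F) : polar r s t = polar s r t := by
  refine LinearMap.ext fun a => ?_
  simp only [polar_eq, polarA, polarB]; ring

theorem polar_comm_right (r s t : OnePoint F) : polar r s t = polar r t s := by
  refine LinearMap.ext fun a => ?_
  simp only [polar_eq, polarA, polarB]; ring

theorem polar_cubicVec (r s t p : OnePoint F) :
    polar r s t (cubicVec p) = bracket p r * bracket p s * bracket p t := by
  simp only [polar_eq, polarA, polarB, cubicVec_eq, bracket, Matrix.cons_val]; ring

/-- A linear form `A y - B x` on the projective line with two zeros vanishes identically. -/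
theorem polarA_polarB_eq_zero {p r s t : OnePoint F} {a : Fin 4 → F} (hpr : p ≠ r)
    (hp : polar p s t a = 0) (hr : polar r s t a = 0) : polarA s t a = 0 ∧ polarB s t a = 0 := by
  rw [polar_eq] at hp hr
  have hb : bracket p r ≠ 0 := mt bracket_eq_zero_iff.1 hpr
  constructor
  · refine (mul_eq_zero.1 (?_ : bracket p r * _ = 0)).resolve_left hb
    unfold bracket; linear_combination homX p * hr - homX r * hp
  · refine (mul_eq_zero.1 (?_ : bracket p r * _ = 0)).resolve_left hb
    unfold bracket; linear_combination homY p * hr - homY r * hp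

theorem exists_polar_eq_zero (s t : OnePoint F) (a : Fin 4 → F) : ∃ r, polar r s t a = 0 := by
  by_cases h : polarB s t a = 0
  · exact ⟨OnePoint.infty, by simp [polar_eq, h, homY]⟩
  · exact ⟨OnePoint.some (polarA s t a / polarB s t a), by
      simp only [polar_eq, homX, homY]; field_simp; ring⟩

/-- The vector `a` represents a point on no bisecant of the twisted cubic. -/
def OffChords (a : Fin 4 → F) : Prop :=
  ∀ s t : OnePoint F, a ∉ Submodule.span F (cubicVec '' {s, t})

/-- In characteristic other than three, the binary cubic attached to a tangent point has
a further root besides the double root at the point of contact. -/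
theorem OffChords.exists_simple_root (h3 : (3 : F) ≠ 0) {a : Fin 4 → F} (ha : OffChords a)
    {s : OnePoint F} (hA : polarA s s a = 0) (hB : polarB s s a = 0) :
    ∃ t, t ≠ s ∧ polar t t t a = 0 := by
  have hs : ∀ c : F, a ≠ c • cubicVec s := fun c hc => ha s s (by
    rw [hc]; exact Submodule.smul_mem _ _ (Submodule.subset_span ⟨s, by simp, rfl⟩))
  induction s using OnePoint.rec with
  | infty =>
    simp only [polarA, polarB, homX, homY] at hA hB
    have h2 : a 2 = 0 := by linear_combination hA
    have h3' : a 3 = 0 := by linear_combination hB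
    have h1 : a 1 ≠ 0 := by
      intro h1
      refine hs (a 0) (funext fun i => ?_)
      fin_cases i <;> simp [cubicVec, h1, h2, h3']
    -- the binary cubic is `a 0 - 3 * a 1 * t`
    refine ⟨OnePoint.some (a 0 / (3 * a 1)), OnePoint.coe_ne_infty _, ?_⟩
    simp only [polar_eq, polarA, polarB, homX, homY, h2, h3']
    field_simp
    ring
  | coe x =>
    simp only [polarA, polarB, homX, homY] at hA hB
    -- the binary cubic is `(t - x) ^ 2 * (3 * a 2 - 2 * a 3 * x - a 3 * t)`; its third root is `∞` when
    -- `a 3 = 0`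
    by_cases h0 : a 3 = 0
    · exact ⟨OnePoint.infty, OnePoint.infty_ne_coe _, by
        simp [polar_eq, polarA, polarB, homX, homY, h0]⟩
    refine ⟨OnePoint.some ((3 * a 2 - 2 * a 3 * x) / a 3), fun h => ?_, ?_⟩
    · -- a triple root at `x` would make `a` a multiple of `cubicVec x`
      rw [OnePoint.coe_eq_coe, div_eq_iff h0] at h
      have h2 : a 2 = a 3 * x := mul_left_cancel₀ h3 (by linear_combination h)
      have h1 : a 1 = a 3 * x ^ 2 := by linear_combination hB + 2 * x * h2
      have h0' : a 0 = a 3 * x ^ 3 := by linear_combination hA + 2 * x * h1 - x ^ 2 * h2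
      refine hs (a 3) (funext fun i => ?_)
      fin_cases i <;> simp [cubicVec, h0', h1, h2]
    · have h1 : a 1 = 2 * a 2 * x - a 3 * x ^ 2 := by linear_combination hB
      have h0' : a 0 = 2 * a 1 * x - a 2 * x ^ 2 := by linear_combination hA
      rw [h1] at h0'
      simp only [polar_eq, polarA, polarB, homX, homY, h0', h1]
      field_simp
      ring

section Independence

variable [Fintype F]

/-- Four points of the twisted cubic are never coplanar: one of them avoids a plane spanned by
three points of the cubic that contains the others. -/
theorem exists_separating_form (hq : 3 ≤ Fintype.card F) {T : Finset (OnePoint F)}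
    (hT : T.card ≤ 4) {p : OnePoint F} (hp : p ∈ T) :
    ∃ f : (Fin 4 → F) →ₗ[F] F, f (cubicVec p) ≠ 0 ∧ ∀ t ∈ T, t ≠ p → f (cubicVec t) = 0 := by
  classical
  obtain ⟨U, hTU, hUp, hU⟩ := Finset.exists_subsuperset_card_eq (n := 3)
    (Finset.erase_subset_erase p (Finset.subset_univ T))
    (by rw [Finset.card_erase_of_mem hp]; omega)
    (by rw [Finset.card_erase_of_mem (Finset.mem_univ _), Finset.card_univ, card_onePoint F]; omega)
  obtain ⟨r, s, t, -, -, -, rfl⟩ := Finset.card_eq_three.1 hU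
  have hne : p ≠ r ∧ p ≠ s ∧ p ≠ t := by
    refine ⟨?_, ?_, ?_⟩ <;> rintro rfl <;> simpa using @hUp p (by simp)
  refine ⟨polar r s t, ?_, fun u hu hup => ?_⟩
  · simp [polar_cubicVec, bracket_eq_zero_iff, hne]
  · have : u ∈ ({r, s, t} : Finset (OnePoint F)) := hTU (Finset.mem_erase.2 ⟨hup, hu⟩)
    simpa [polar_cubicVec, bracket_eq_zero_iff, or_assoc] using this

theorem linearIndepOn_cubicVec (hq : 3 ≤ Fintype.card F) {T : Finset (OnePoint F)}
    (hT : T.card ≤ 4) : LinearIndepOn F cubicVec (T : Set (OnePoint F)) := by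
  rw [linearIndepOn_finset_iff]
  intro c hc p hp
  obtain ⟨f, hf, hf0⟩ := exists_separating_form hq hT hp
  have h := congrArg f hc
  rw [map_sum, Finset.sum_eq_single_of_mem p hp
    (fun t ht htp => by rw [map_smul, hf0 t ht htp, smul_zero]), map_smul, map_zero] at h
  exact (smul_eq_zero.1 h).resolve_right hf

theorem finrank_span_cubicVec (hq : 3 ≤ Fintype.card F) {T : Finset (OnePoint F)}
    (hT : T.card ≤ 4) :
    Module.finrank F (Submodule.span F (cubicVec '' (T : Set (OnePoint F)))) = T.card := by
  rw [Set.image_eq_range]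
  exact (finrank_span_eq_card (linearIndepOn_cubicVec hq hT)).trans (Fintype.card_coe T)

theorem span_cubicVec_eq_top (hq : 3 ≤ Fintype.card F) {T : Finset (OnePoint F)}
    (hT : T.card = 4) : Submodule.span F (cubicVec '' (T : Set (OnePoint F))) = ⊤ := by
  apply Submodule.eq_top_of_finrank_eq
  rw [finrank_span_cubicVec hq hT.le, hT, Module.finrank_fin_fun]

/-- A vector lies in the span of some of the vectors of a basis of points of the cubic as soon as
its other coordinates vanish. -/
theorem mem_span_cubicVec_of_forms (hq : 3 ≤ Fintype.card F) {T U : Finset (OnePoint F)}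
    (hU : U.card = 4) {a : Fin 4 → F}
    (h : ∀ p ∈ U, p ∉ T → ∃ f : (Fin 4 → F) →ₗ[F] F, f (cubicVec p) ≠ 0 ∧
      (∀ t ∈ U, t ≠ p → f (cubicVec t) = 0) ∧ f a = 0) :
    a ∈ Submodule.span F (cubicVec '' (T : Set (OnePoint F))) := by
  have ha : a ∈ Submodule.span F (cubicVec '' (U : Set (OnePoint F))) := by
    rw [span_cubicVec_eq_top hq hU]; trivial
  obtain ⟨c, rfl⟩ := (Submodule.mem_span_image_finset_iff_exists_fun' F).1 ha
  refine Submodule.sum_mem _ fun p hp => ?_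
  by_cases hpT : p ∈ T
  · exact Submodule.smul_mem _ _ (Submodule.subset_span ⟨p, hpT, rfl⟩)
  · obtain ⟨f, hf, hf0, hfa⟩ := h p hp hpT
    rw [map_sum, Finset.sum_eq_single_of_mem p hp
      (fun t ht htp => by rw [map_smul, hf0 t ht htp, smul_zero]), map_smul] at hfa
    rw [(smul_eq_zero.1 hfa).resolve_right hf, zero_smul]
    exact Submodule.zero_mem _

open Classical in
theorem mem_span_of_polar_eq_zero (hq : 3 ≤ Fintype.card F) {r s t : OnePoint F} (hrs : r ≠ s)
    (hrt : r ≠ t) (hst : s ≠ t) {a : Fin 4 → F} (h : polar r s t a = 0) :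
    a ∈ Submodule.span F (cubicVec '' (({r, s, t} : Finset (OnePoint F)) : Set (OnePoint F))) := by
  have hc : ({r, s, t} : Finset (OnePoint F)).card = 3 := by
    simp [hrs, hrt, hst]
  obtain ⟨p, hp⟩ := exists_notMem_of_card_le_three hq hc.le
  refine mem_span_cubicVec_of_forms hq (U := insert p {r, s, t})
    (by rw [Finset.card_insert_of_notMem hp, hc]) fun u hu huT => ?_
  obtain rfl : u = p := (Finset.mem_insert.1 hu).resolve_right huT
  refine ⟨polar r s t, ?_, fun v hv hvu => ?_, h⟩
  · simpa [polar_cubicVec, bracket_eq_zero_iff, and_assoc] using hp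
  · have := (Finset.mem_insert.1 hv).resolve_left hvu
    simpa [polar_cubicVec, bracket_eq_zero_iff, or_assoc] using this

open Classical in
theorem OffChords.eq_of_polar_eq_zero (hq : 3 ≤ Fintype.card F) {a : Fin 4 → F} (ha : OffChords a)
    {p r s t : OnePoint F} (hst : s ≠ t) (hp : polar p s t a = 0) (hr : polar r s t a = 0) :
    p = r := by
  by_contra hpr
  obtain ⟨hA, hB⟩ := polarA_polarB_eq_zero hpr hp hr
  have h0 (u) : polar u s t a = 0 := by rw [polar_eq, hA, hB]; ring
  have hc : ({s, t} : Finset (OnePoint F)).card = 2 := Finset.card_pair hst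
  obtain ⟨u, hu⟩ := exists_notMem_of_card_le_three hq (hc.trans_le (by norm_num))
  have hc' : (insert u {s, t} : Finset (OnePoint F)).card = 3 := by
    rw [Finset.card_insert_of_notMem hu, hc]
  obtain ⟨v, hv⟩ := exists_notMem_of_card_le_three hq hc'.le
  have hs := mem_span_cubicVec_of_forms hq (T := {s, t}) (U := insert v (insert u {s, t})) (a := a)
    (by rw [Finset.card_insert_of_notMem hv, hc'])
    (fun w hw hwT => by
      simp only [Finset.mem_insert, Finset.mem_singleton, not_or] at hu hv hw hwT
      rcases hw with rfl | rfl | hw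
      · refine ⟨polar u s t, by simp [polar_cubicVec, bracket_eq_zero_iff, hv], ?_, h0 u⟩
        intro x hx hxw
        simp only [Finset.mem_insert, Finset.mem_singleton] at hx
        simpa [polar_cubicVec, bracket_eq_zero_iff, or_assoc] using hx.resolve_left hxw
      · refine ⟨polar v s t, ?_, ?_, h0 v⟩
        · simp [polar_cubicVec, bracket_eq_zero_iff, hu, Ne.symm hv.1]
        intro x hx hxw
        simp only [Finset.mem_insert, Finset.mem_singleton] at hx
        simp only [polar_cubicVec, mul_eq_zero, bracket_eq_zero_iff]
        tauto
      · tauto)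
  exact ha s t (by simpa using hs)

/-- A point off the chords lies on at most one tangent: a point on two tangents would lie on
the chord through the points of contact. -/
theorem OffChords.tangent_unique (hq : 3 ≤ Fintype.card F) {a : Fin 4 → F} (ha : OffChords a)
    {s t : OnePoint F} (hs : polarA s s a = 0 ∧ polarB s s a = 0)
    (ht : polarA t t a = 0 ∧ polarB t t a = 0) : s = t := by
  by_contra hst
  refine hst (ha.eq_of_polar_eq_zero hq hst ?_ ?_)
  · rw [polar_comm_right, polar_comm_left, polar_eq, hs.1, hs.2]; ring
  · rw [polar_comm_left, polar_eq, ht.1, ht.2]; ring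

end Independence

end Polar

/-! ### Counting the trisecant planes through a point off the chords -/

/-- The point is on the tangent at `P(∞)`, which meets no bisecant outside `P(∞)`. -/
theorem offChords_tangent_point {F : Type*} [Field F] : OffChords (![0, 1, 0, 0] : Fin 4 → F) := by
  intro s t h
  rw [Set.image_pair, Submodule.mem_span_pair] at h
  obtain ⟨b, c, h⟩ := h
  have h0 := congrFun h 0
  have h1 := congrFun h 1
  have h2 := congrFun h 2
  have h3 := congrFun h 3
  induction s using OnePoint.rec <;> induction t using OnePoint.rec <;>
    simp [cubicVec] at h0 h1 h2 h3
  · simp_all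
  · simp_all
  · rename_i x y
    have : b = -c := by linear_combination h3
    subst this
    exact one_ne_zero (α := F) (by linear_combination -h1 + (x + y) * h2)

section Counting

variable {F : Type*} [Field F] [Fintype F]

theorem three_ne_zero_of_not_dvd_card (h : ¬ 3 ∣ Fintype.card F) : (3 : F) ≠ 0 := by
  intro h3
  have hc : ((Fintype.card F : ℤ) : F) = 0 := by exact_mod_cast Nat.cast_card_eq_zero F
  obtain ⟨u, v, huv⟩ : IsCoprime (3 : ℤ) (Fintype.card F : ℤ) := by
    exact_mod_cast (Nat.Coprime.isCoprime ((Nat.Prime.coprime_iff_not_dvd Nat.prime_three).2 h))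
  have h1 := congrArg (Int.cast : ℤ → F) huv
  push_cast at h1 hc
  rw [h3, hc] at h1
  simp at h1

theorem six_mul_mu_of_dvd {q : ℕ} (hq : 3 ≤ q) (h : 3 ∣ q) : 6 * mu q + 3 * q = q ^ 2 := by
  obtain ⟨k, rfl⟩ : ∃ k, q = k + 3 := ⟨q - 3, by omega⟩
  have hle : 3 * (k + 3) ≤ (k + 3) ^ 2 := by nlinarith
  have hd : 6 ∣ (k + 3) ^ 2 - 3 * (k + 3) := by
    have h1 : (k + 3) ^ 2 - 3 * (k + 3) = (k + 3) * k := by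
      rw [Nat.sub_eq_iff_eq_add hle]; ring
    rw [h1]
    refine Nat.Coprime.mul_dvd_of_dvd_of_dvd (m := 2) (n := 3) (by norm_num) ?_ (h.mul_right _)
    have := Nat.even_mul_succ_self k
    rw [even_iff_two_dvd] at this
    obtain ⟨c, hc⟩ := this
    exact ⟨c + k, by rw [mul_add, ← hc]; ring⟩
  rw [mu, if_pos h, Nat.mul_div_cancel' hd]
  omega

theorem six_mul_mu_of_not_dvd {q : ℕ} (hq : 3 ≤ q) (h : ¬ 3 ∣ q) :
    6 * mu q + 3 * q = q ^ 2 + 2 := by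
  obtain ⟨k, rfl⟩ : ∃ k, q = k + 3 := ⟨q - 3, by omega⟩
  have hle : 3 * (k + 3) ≤ (k + 3) ^ 2 := by nlinarith
  have hd : 6 ∣ (k + 3) ^ 2 - 3 * (k + 3) + 2 := by
    have h1 : (k + 3) ^ 2 - 3 * (k + 3) + 2 = (k + 1) * (k + 2) := by
      have : (k + 3) ^ 2 - 3 * (k + 3) = (k + 3) * k := by
        rw [Nat.sub_eq_iff_eq_add hle]; ring
      rw [this]; ring
    rw [h1]
    refine Nat.Coprime.mul_dvd_of_dvd_of_dvd (m := 2) (n := 3) (by norm_num) ?_ ?_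
    · exact even_iff_two_dvd.1 (Nat.even_mul_succ_self (k + 1))
    · have : k % 3 = 1 ∨ k % 3 = 2 := by omega
      rcases this with h | h
      · exact Dvd.dvd.mul_left (by omega) _
      · exact Dvd.dvd.mul_right (by omega) _
  rw [mu, if_neg h, Nat.mul_div_cancel' hd]
  omega

open Classical in
/-- The ordered pairs of distinct parameters `s`, `t` such that the plane through `P(t)` containing
the tangent at `P(s)` passes through the point `a`. -/
noncomputable def tangentPairs (a : Fin 4 → F) : Finset (OnePoint F × OnePoint F) :=
  Finset.univ.filter fun p => p.1 ≠ p.2 ∧ polar p.2 p.1 p.1 a = 0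

open Classical in
/-- If `a` is on no tangent at a point with parameter in `S`, each of these parameters is the first
component of at most one tangent pair, and of none if it is a root of the binary cubic
`polar s s s a`; the set `S'` contains the parameters that are not roots. -/
theorem card_filter_tangentPairs_le {a : Fin 4 → F} {S S' : Finset (OnePoint F)}
    (hS : ∀ s ∈ S, ¬ (polarA s s a = 0 ∧ polarB s s a = 0))
    (hS' : ∀ s ∈ S, s ∉ S' → polar s s s a = 0) :
    ((tangentPairs a).filter fun p => p.1 ∈ S).card ≤ S'.card := by
  refine Finset.card_le_card_of_injOn Prod.fst (fun p hp => ?_) fun p hp p' hp' h => ?_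
  · simp only [tangentPairs, Finset.coe_filter, Set.mem_ofPred_eq, Finset.mem_filter,
      Finset.mem_univ, true_and] at hp
    by_contra hn
    exact hS _ hp.2 (polarA_polarB_eq_zero hp.1.1 (hS' _ hp.2 hn) hp.1.2)
  · simp only [tangentPairs, Finset.coe_filter, Set.mem_ofPred_eq, Finset.mem_filter,
      Finset.mem_univ, true_and] at hp hp'
    refine Prod.ext h (by_contra fun hne => hS _ hp.2 (polarA_polarB_eq_zero hne hp.1.2 ?_))
    rw [h]; exact hp'.1.2

open Classical in
theorem card_tangentPairs_le (hq : 3 ≤ Fintype.card F) {a : Fin 4 → F} (ha : OffChords a) :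
    (tangentPairs a).card ≤ Fintype.card F + 1 ∨
      ((3 : F) ≠ 0 ∧ (tangentPairs a).card + 1 ≤ 2 * Fintype.card F) ∨
      ((3 : F) = 0 ∧ (tangentPairs a).card ≤ 2 * Fintype.card F) := by
  by_cases h : ∃ s, polarA s s a = 0 ∧ polarB s s a = 0
  · right
    obtain ⟨s, hs⟩ := h
    have hsplit := Finset.card_filter_add_card_filter_not (s := tangentPairs a)
      (fun p => p.1 ∈ Finset.univ.erase s)
    have h2 : ((tangentPairs a).filter fun p => ¬ p.1 ∈ Finset.univ.erase s).card ≤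
        (Finset.univ.erase s).card := by
      refine Finset.card_le_card_of_injOn Prod.snd (fun p hp => ?_) fun p hp p' hp' h => ?_
      · simp only [tangentPairs, Finset.coe_filter, Set.mem_ofPred_eq, Finset.mem_filter,
          Finset.mem_univ, true_and, Finset.mem_erase, and_true, not_not] at hp
        simpa using fun h => hp.1.1 (hp.2.trans h.symm)
      · simp only [Finset.coe_filter, Set.mem_ofPred_eq, Finset.mem_univ, Finset.mem_erase,
          and_true, not_not] at hp hp'
        exact Prod.ext (hp.2.trans hp'.2.symm) h
    have hS : ∀ t ∈ Finset.univ.erase s, ¬ (polarA t t a = 0 ∧ polarB t t a = 0) := fun t ht h =>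
      (Finset.mem_erase.1 ht).1 (ha.tangent_unique hq h hs)
    have hc : (Finset.univ.erase s).card = Fintype.card F := by
      rw [Finset.card_erase_of_mem (Finset.mem_univ _), Finset.card_univ, card_onePoint F,
        Nat.add_sub_cancel]
    by_cases h3 : (3 : F) = 0
    · have h1 := card_filter_tangentPairs_le hS (fun s hs hn => absurd hs hn)
      exact Or.inr ⟨h3, by omega⟩
    · obtain ⟨t, hts, ht⟩ := ha.exists_simple_root h3 hs.1 hs.2
      have h1 := card_filter_tangentPairs_le (S' := (Finset.univ.erase s).erase t) hS
        (fun u hu hn => by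
          obtain rfl : u = t := by simpa [(Finset.mem_erase.1 hu).1] using hn
          exact ht)
      rw [Finset.card_erase_of_mem (by simpa using hts), hc] at h1
      exact Or.inl ⟨h3, by omega⟩
  · left
    push Not at h
    have h1 := card_filter_tangentPairs_le (a := a) (S := Finset.univ) (S' := Finset.univ)
      (fun s _ hs => h s hs.1 hs.2) (fun s hs hn => absurd hs hn)
    simpa [card_onePoint] using h1

open Classical in
/-- The triples of points of the cubic whose plane passes through the point `a`. -/
noncomputable def planesThrough (a : Fin 4 → F) : Finset (Finset (OnePoint F)) :=
  (Finset.powersetCard 3 Finset.univ).filter fun T =>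
    a ∈ Submodule.span F (cubicVec '' (T : Set (OnePoint F)))

open Classical in
/-- Two distinct parameters `s`, `t` determine a third one, `r`, with `polar r s t a = 0`. It is
different from `s` and `t`, and so gives a plane through `a`, unless `(s, t)` or `(t, s)` is
a tangent pair; every plane arises from six ordered pairs. -/
theorem card_pairs_le (hq : 3 ≤ Fintype.card F) (a : Fin 4 → F) :
    Fintype.card F * (Fintype.card F + 1) ≤
      6 * (planesThrough a).card + 2 * (tangentPairs a).card := by
  choose third hthird using fun p : OnePoint F × OnePoint F => exists_polar_eq_zero p.1 p.2 a
  set E : Finset (OnePoint F × OnePoint F) := Finset.univ.offDiag with hE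
  have hEc : E.card = Fintype.card F * (Fintype.card F + 1) := by
    rw [hE, Finset.offDiag_card, Finset.card_univ, card_onePoint F, ← Nat.mul_sub_one,
      Nat.add_sub_cancel, mul_comm]
  set B := tangentPairs a ∪ (tangentPairs a).image Prod.swap with hB
  have hBc : B.card ≤ 2 * (tangentPairs a).card := by
    have h1 := Finset.card_union_le (tangentPairs a) ((tangentPairs a).image Prod.swap)
    have h2 := Finset.card_image_le (s := tangentPairs a) (f := Prod.swap)
    rw [hB]; omega
  have hne : ∀ p ∈ E \ B, p.1 ≠ p.2 ∧ third p ≠ p.1 ∧ third p ≠ p.2 := by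
    rintro ⟨s, t⟩ hp
    have h0 := hthird (s, t)
    simp only [hE, hB, Finset.mem_sdiff, Finset.mem_offDiag, Finset.mem_univ, true_and,
      Finset.mem_union, Finset.mem_image, not_or] at hp
    refine ⟨hp.1, fun h => hp.2.1 ?_, fun h => hp.2.2 ⟨(t, s), ?_, rfl⟩⟩
    · rw [h] at h0
      simp only [tangentPairs, Finset.mem_filter, Finset.mem_univ, true_and]
      exact ⟨hp.1, by rw [polar_comm_left, polar_comm_right]; exact h0⟩
    · rw [h] at h0
      simp only [tangentPairs, Finset.mem_filter, Finset.mem_univ, true_and]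
      exact ⟨Ne.symm hp.1, by rw [polar_comm_left]; exact h0⟩
  have hmain := Finset.card_le_mul_card_image_of_maps_to (s := E \ B) (t := planesThrough a)
    (f := fun p => {third p, p.1, p.2}) (fun p hp => by
      obtain ⟨h1, h2, h3⟩ := hne p hp
      simp only [planesThrough, Finset.mem_filter, Finset.mem_powersetCard, Finset.subset_univ,
        true_and]
      exact ⟨Finset.card_eq_three.2 ⟨_, _, _, h2, h3, h1, rfl⟩,
        mem_span_of_polar_eq_zero hq h2 h3 h1 (hthird p)⟩) 6 (fun T hT => by
      have hT3 : T.card = 3 := by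
        simp only [planesThrough, Finset.mem_filter, Finset.mem_powersetCard] at hT
        exact hT.1.2
      calc _ ≤ T.offDiag.card := Finset.card_le_card fun p hp => by
            obtain ⟨hpE, rfl⟩ := Finset.mem_filter.1 hp
            simp [Finset.mem_offDiag, (hne p hpE).1]
        _ = 6 := by rw [Finset.offDiag_card, hT3])
  have := Finset.le_card_sdiff B E
  omega

theorem mu_le_card_planesThrough (hq : 3 ≤ Fintype.card F) {a : Fin 4 → F} (ha : OffChords a) :
    mu (Fintype.card F) ≤ (planesThrough a).card := by
  have h := card_pairs_le hq a
  generalize hQ : Fintype.card F = q at *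
  rcases card_tangentPairs_le (hQ ▸ hq) ha with h1 | ⟨h3, h1⟩ | ⟨h3, h1⟩ <;> rw [hQ] at h1
  · by_cases hd : 3 ∣ q
    · have := six_mul_mu_of_dvd hq hd; nlinarith
    · have := six_mul_mu_of_not_dvd hq hd; nlinarith
  · by_cases hd : 3 ∣ q
    · have := six_mul_mu_of_dvd hq hd; nlinarith
    · have := six_mul_mu_of_not_dvd hq hd; nlinarith
  · have hd : 3 ∣ q := by
      by_contra hd
      exact three_ne_zero_of_not_dvd_card (hQ ▸ hd) h3
    have := six_mul_mu_of_dvd hq hd; nlinarith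

end Counting

/-! ### The twisted cubic as a minimal saturating set -/

theorem submodule_span_image_mk {K V α : Type*} [DivisionRing K] [AddCommGroup V] [Module K V]
    {v : α → V} (hv : ∀ t, v t ≠ 0) (T : Set α) :
    Projectivization.Subspace.submodule
      (Projectivization.Subspace.span ((fun t => Projectivization.mk K (v t) (hv t)) '' T)) =
      Submodule.span K (v '' T) := by
  apply le_antisymm
  · rw [← OrderIso.le_symm_apply, Projectivization.Subspace.span_le_subspace_iff]
    rintro _ ⟨t, ht, rfl⟩
    exact (Submodule.mk_mem_projectivization_iff _ _).2 (Submodule.subset_span ⟨t, ht, rfl⟩)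
  · rw [Submodule.span_le]
    rintro _ ⟨t, ht, rfl⟩
    exact (Projectivization.Subspace.mem_submodule_iff _ (hv t)).2
      (Projectivization.Subspace.subset_span _ ⟨t, ht, rfl⟩)

section Saturating

variable {F : Type*} [Field F]

/-- The point of the twisted cubic with parameter `t`. -/
def cubicPoint (t : OnePoint F) : ℙ F (Fin 4 → F) :=
  Projectivization.mk F (cubicVec t) (cubicVec_ne_zero t)

theorem twistedCubic_eq_range : twistedCubic F = Set.range cubicPoint := rfl

theorem twistedCubic_eq_image : twistedCubic F = cubicPoint '' Set.univ := by
  rw [Set.image_univ, twistedCubic_eq_range]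

theorem mk_mem_span_cubicPoint {T : Set (OnePoint F)} {a : Fin 4 → F} (ha : a ≠ 0) :
    Projectivization.mk F a ha ∈ Projectivization.Subspace.span (cubicPoint '' T) ↔
      a ∈ Submodule.span F (cubicVec '' T) := by
  rw [← Projectivization.Subspace.mem_submodule_iff]
  exact iff_of_eq (congrArg (a ∈ ·) (submodule_span_image_mk cubicVec_ne_zero T))

variable [Fintype F]

theorem mem_span_cubicVec_iff (hq : 3 ≤ Fintype.card F) {T : Finset (OnePoint F)}
    (hT : T.card ≤ 3) {p : OnePoint F} :
    cubicVec p ∈ Submodule.span F (cubicVec '' (T : Set (OnePoint F))) ↔ p ∈ T := by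
  classical
  refine ⟨fun h => by_contra fun hp => ?_, fun h => Submodule.subset_span ⟨p, h, rfl⟩⟩
  refine ((linearIndepOn_cubicVec hq (hT.trans (by norm_num))).notMem_span_iff.2 ⟨?_, by simpa⟩) h
  rw [← Finset.coe_insert]
  exact linearIndepOn_cubicVec hq (by rw [Finset.card_insert_of_notMem hp]; omega)

theorem cubicPoint_injective (hq : 3 ≤ Fintype.card F) :
    Function.Injective (cubicPoint : OnePoint F → ℙ F (Fin 4 → F)) := by
  intro s t h
  rw [cubicPoint, cubicPoint, Projectivization.mk_eq_mk_iff'] at h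
  obtain ⟨c, hc⟩ := h
  have h1 := (mem_span_cubicVec_iff hq (T := {t}) (p := s) (by simp)).1 (by
    rw [← hc]; exact Submodule.smul_mem _ _ (Submodule.subset_span ⟨t, by simp, rfl⟩))
  simpa using h1

theorem ncard_twistedCubic (hq : 3 ≤ Fintype.card F) :
    (twistedCubic F).ncard = Fintype.card F + 1 := by
  rw [twistedCubic_eq_range, ← Set.image_univ, Set.ncard_image_of_injective _
    (cubicPoint_injective hq), Set.ncard_univ, Nat.card_eq_fintype_card, card_onePoint]

theorem card_of_finrank_span (hq : 3 ≤ Fintype.card F) {T : Finset (OnePoint F)} {m : ℕ}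
    (hm : m ≤ 3)
    (hT : Module.finrank F (Submodule.span F (cubicVec '' (T : Set (OnePoint F)))) = m) :
    T.card = m := by
  rcases le_or_gt T.card 4 with h | h
  · rw [← hT, finrank_span_cubicVec hq h]
  · obtain ⟨U, hUT, hU⟩ := Finset.exists_subset_card_eq h.le
    have h1 : Submodule.span F (cubicVec '' (T : Set (OnePoint F))) = ⊤ := by
      rw [eq_top_iff, ← span_cubicVec_eq_top hq hU]
      exact Submodule.span_mono (Set.image_mono hUT)
    rw [h1, finrank_top, Module.finrank_fin_fun] at hT
    omega

open Classical in
/-- For `m ≤ 3`, the subspaces of vector space dimension `m` generated by points of the cubic with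
parameters in `S` are those generated by `m` of them. -/
theorem mem_generatedSubspaces_iff (hq : 3 ≤ Fintype.card F) {m : ℕ} (hm : m ≤ 3)
    {S : Set (OnePoint F)} {W : Projectivization.Subspace F (Fin 4 → F)} :
    W ∈ generatedSubspaces (cubicPoint '' S) m ↔ ∃ T : Finset (OnePoint F), (T : Set _) ⊆ S ∧
      T.card = m ∧ Projectivization.Subspace.span (cubicPoint '' (T : Set (OnePoint F))) = W := by
  constructor
  · rintro ⟨hr, T, hT, rfl⟩
    obtain ⟨T', hT', rfl⟩ := Set.subset_image_iff.1 hT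
    refine ⟨T'.toFinset, by simpa using hT', card_of_finrank_span hq hm ?_, by simp⟩
    rw [← hr, Set.coe_toFinset]
    exact congrArg (fun U : Submodule F (Fin 4 → F) => Module.finrank F U)
      (submodule_span_image_mk cubicVec_ne_zero T').symm
  · rintro ⟨T, hT, hc, rfl⟩
    refine ⟨?_, _, Set.image_mono hT, rfl⟩
    rw [← hc, ← finrank_span_cubicVec hq (T := T) (by omega)]
    exact congrArg (fun U : Submodule F (Fin 4 → F) => Module.finrank F U)
      (submodule_span_image_mk cubicVec_ne_zero (T : Set (OnePoint F)))

open Classical in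
theorem offChords_iff (hq : 3 ≤ Fintype.card F) {a : Fin 4 → F} (ha : a ≠ 0) :
    OffChords a ↔
      ∀ W ∈ generatedSubspaces (twistedCubic F) 2, Projectivization.mk F a ha ∉ W := by
  simp only [twistedCubic_eq_image, mem_generatedSubspaces_iff hq (show 2 ≤ 3 by norm_num)]
  constructor
  · rintro h _ ⟨T, -, hT, rfl⟩
    obtain ⟨s, t, -, rfl⟩ := Finset.card_eq_two.1 hT
    rw [mk_mem_span_cubicPoint]
    simpa using h s t
  · intro h s t hst
    obtain ⟨T, hT, -, hT2⟩ := Finset.exists_subsuperset_card_eq (n := 2)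
      (Finset.subset_univ {s, t}) Finset.card_le_two
      (by rw [Finset.card_univ, card_onePoint F]; omega)
    refine h _ ⟨T, Set.subset_univ _, hT2, rfl⟩ ((mk_mem_span_cubicPoint ha).2 ?_)
    exact Submodule.span_mono (Set.image_mono (by simpa using Finset.coe_subset.2 hT)) hst

theorem mu_pos {q : ℕ} (hq : 5 ≤ q) : 0 < mu q := by
  by_cases hd : 3 ∣ q
  · have := six_mul_mu_of_dvd (by omega) hd; nlinarith
  · have := six_mul_mu_of_not_dvd (by omega) hd; nlinarith

theorem isSaturating_twistedCubic (hq : 3 ≤ Fintype.card F) :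
    IsSaturating 2 (mu (Fintype.card F)) (twistedCubic F) where
  generates := by
    obtain ⟨U, -, hU⟩ := Finset.exists_subset_card_eq (s := (Finset.univ : Finset (OnePoint F)))
      (n := 4) (by rw [Finset.card_univ, card_onePoint F]; omega)
    rw [eq_top_iff]
    rintro Q -
    induction Q with | h a ha =>
    rw [twistedCubic_eq_image, mk_mem_span_cubicPoint]
    refine Submodule.span_mono (Set.image_mono (Set.subset_univ (U : Set (OnePoint F)))) ?_
    rw [span_cubicVec_eq_top hq hU]
    trivial
  exists_uncovered :=
    ⟨Projectivization.mk F ![0, 1, 0, 0] (fun h => one_ne_zero (congrFun h 1)),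
      (offChords_iff hq _).1 offChords_tangent_point⟩
  le_count Q hQ := by
    induction Q with | h a ha =>
    have hoff := (offChords_iff hq ha).2 hQ
    have : Finite (Projectivization.Subspace F (Fin 4 → F)) :=
      Finite.of_equiv _ Projectivization.Subspace.submodule.symm.toEquiv
    have hcard {T : Finset (OnePoint F)} (hT : T ∈ planesThrough a) : T.card = 3 ∧
        a ∈ Submodule.span F (cubicVec '' (T : Set (OnePoint F))) := by
      simpa [planesThrough, Finset.mem_powersetCard] using hT
    refine (mu_le_card_planesThrough hq hoff).trans ?_
    rw [← Set.ncard_coe_finset]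
    refine Set.ncard_le_ncard_of_injOn
      (fun T => Projectivization.Subspace.span (cubicPoint '' (T : Set (OnePoint F))))
      (fun T hT => ⟨?_, ?_⟩) (fun T hT T' hT' h => ?_) (Set.toFinite _)
    · rw [twistedCubic_eq_image, mem_generatedSubspaces_iff hq (by norm_num)]
      exact ⟨T, Set.subset_univ _, (hcard hT).1, rfl⟩
    · exact (mk_mem_span_cubicPoint ha).2 (hcard hT).2
    · have hc := (hcard hT).1
      have hc' := (hcard hT').1
      refine Finset.eq_of_subset_of_card_le (fun t ht => ?_) (by omega)
      rw [← mem_span_cubicVec_iff hq hc'.le, ← mk_mem_span_cubicPoint (cubicVec_ne_zero t)]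
      rw [← show _ = Projectivization.Subspace.span _ from h, mk_mem_span_cubicPoint,
        mem_span_cubicVec_iff hq hc.le]
      exact ht

/-- A point removed from the cubic lies on no line or plane generated by the other points. -/
theorem isMinimalSaturating_twistedCubic (hq : 5 ≤ Fintype.card F) :
    IsMinimalSaturating 2 (mu (Fintype.card F)) (twistedCubic F) := by
  have hq3 : 3 ≤ Fintype.card F := by omega
  refine ⟨isSaturating_twistedCubic hq3, fun T hT hc hsat => ?_⟩
  obtain ⟨S, hS⟩ : ∃ S, cubicPoint '' S = T := Set.subset_range_iff_exists_image_eq.1 hT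
  subst hS
  obtain ⟨p, hp⟩ : ∃ p, p ∉ S := by
    by_contra! h
    rw [Set.eq_univ_of_forall h, ← twistedCubic_eq_image] at hc
    omega
  have hnot {m : ℕ} (hm : m ≤ 3) :
      ∀ W ∈ generatedSubspaces (cubicPoint '' S) m, cubicPoint p ∉ W := by
    intro W hW
    obtain ⟨U, hU, hUc, rfl⟩ := (mem_generatedSubspaces_iff hq3 hm).1 hW
    rw [cubicPoint, mk_mem_span_cubicPoint, mem_span_cubicVec_iff hq3 (hUc.trans_le hm)]
    exact fun h => hp (hU h)
  have h := hsat.le_count (cubicPoint p) (hnot (by norm_num))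
  have he : {W ∈ generatedSubspaces (cubicPoint '' S) (2 + 1) | cubicPoint p ∈ W} = ∅ :=
    Set.eq_empty_of_forall_notMem fun W hW => hnot (by norm_num) W hW.1 hW.2
  have he' := h.trans_eq (congrArg Set.ncard he)
  rw [Set.ncard_empty] at he'
  have := mu_pos hq
  omega

end Saturating

/-! ### Codes whose parity-check columns are in general position -/

section GeneralCodes

variable {F ι : Type*} [Field F] [Fintype ι] {m : ℕ} {h : ι → Fin m → F}

theorem codeOfColumns_eq_ker (h : ι → Fin m → F) :
    codeOfColumns h = LinearMap.ker (Fintype.linearCombination F h) := by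
  ext x
  simp only [codeOfColumns, LinearMap.mem_ker, Matrix.mulVecLin_apply,
    Fintype.linearCombination_apply]
  refine iff_of_eq (congrArg (· = 0) (funext fun i => ?_))
  simp [Matrix.mulVec, dotProduct, mul_comm]

open Classical in
/-- The support of a vector, whose cardinality is the Hamming norm. -/
noncomputable def supp (c : ι → F) : Finset ι := Finset.univ.filter fun j => c j ≠ 0

theorem mem_supp {c : ι → F} {j : ι} : j ∈ supp c ↔ c j ≠ 0 := by simp [supp]

open Classical in
theorem hammingNorm_eq_card_supp (c : ι → F) : hammingNorm c = (supp c).card := rfl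

theorem linearCombination_eq_sum {S : Finset ι} {c : ι → F} (hc : supp c ⊆ S) :
    Fintype.linearCombination F h c = ∑ j ∈ S, c j • h j := by
  rw [Fintype.linearCombination_apply]
  refine (Finset.sum_subset (Finset.subset_univ S) fun j _ hj => ?_).symm
  rw [not_ne_iff.1 (mt mem_supp.2 fun h => hj (hc h)), zero_smul]

theorem mem_span_columns_iff {S : Finset ι} {y : Fin m → F} :
    y ∈ Submodule.span F (h '' (S : Set ι)) ↔
      ∃ c, supp c ⊆ S ∧ Fintype.linearCombination F h c = y := by
  classical
  constructor
  · intro hy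
    obtain ⟨c, rfl⟩ := (Submodule.mem_span_image_finset_iff_exists_fun' F).1 hy
    have hc : supp (fun j => if j ∈ S then c j else 0) ⊆ S := fun j hj => by
      by_contra hn
      exact mem_supp.1 hj (if_neg hn)
    exact ⟨_, hc, (linearCombination_eq_sum hc).trans
      (Finset.sum_congr rfl fun j hj => by rw [if_pos hj])⟩
  · rintro ⟨c, hc, rfl⟩
    rw [linearCombination_eq_sum hc]
    exact Submodule.sum_mem _ fun j hj => Submodule.smul_mem _ _ (Submodule.subset_span ⟨j, hj, rfl⟩)

open Classical in
theorem hammingDist_eq_card_supp (x y : ι → F) : hammingDist x y = (supp (x - y)).card := by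
  unfold hammingDist supp
  simp [sub_ne_zero]

open Classical in
theorem hammingDist_sub_right_eq (x e : ι → F) : hammingDist x (x - e) = hammingNorm e := by
  rw [hammingDist_eq_card_supp, sub_sub_cancel, hammingNorm_eq_card_supp]

open Classical in
theorem distToCode_le_hammingDist {C : Submodule F (ι → F)} (x : ι → F) {c : ι → F} (hc : c ∈ C) :
    distToCode x C ≤ hammingDist x c :=
  Nat.sInf_le (show hammingDist x c ∈ {w | ∃ c ∈ C, hammingDist x c = w} from ⟨c, hc, rfl⟩)

open Classical in
/-- The distance to a code is the least weight of a vector with the given syndrome. -/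
theorem distToCode_le_iff {x : ι → F} {w : ℕ} :
    distToCode x (codeOfColumns h) ≤ w ↔ ∃ e, hammingNorm e ≤ w ∧
      Fintype.linearCombination F h e = Fintype.linearCombination F h x := by
  constructor
  · intro hw
    obtain ⟨c, hc, hd⟩ := Nat.sInf_mem
      (s := {w | ∃ c ∈ codeOfColumns h, hammingDist x c = w}) ⟨_, 0, Submodule.zero_mem _, rfl⟩
    refine ⟨x - c, ?_, ?_⟩
    · rw [hammingNorm_eq_card_supp, ← hammingDist_eq_card_supp]; exact hd.trans_le hw
    · rw [codeOfColumns_eq_ker, LinearMap.mem_ker] at hc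
      rw [map_sub, hc, sub_zero]
  · rintro ⟨e, he, hex⟩
    suffices hC : x - e ∈ codeOfColumns h from
      (distToCode_le_hammingDist x hC).trans ((hammingDist_sub_right_eq x e).trans_le he)
    rw [codeOfColumns_eq_ker, LinearMap.mem_ker, map_sub, hex, sub_self]

theorem distToCode_le_iff_mem_span {x : ι → F} {w : ℕ} :
    distToCode x (codeOfColumns h) ≤ w ↔ ∃ S : Finset ι, S.card ≤ w ∧
      Fintype.linearCombination F h x ∈ Submodule.span F (h '' (S : Set ι)) := by
  simp only [distToCode_le_iff, mem_span_columns_iff]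
  constructor
  · rintro ⟨e, he, hex⟩
    exact ⟨supp e, he, e, subset_rfl, hex⟩
  · rintro ⟨S, hS, e, he, hex⟩
    exact ⟨e, (Finset.card_le_card he).trans hS, hex⟩

/-- The columns are in general position: any `m` of them, where `m` is the redundancy, are
linearly independent. -/
def InGeneralPosition (h : ι → Fin m → F) : Prop :=
  ∀ S : Finset ι, S.card ≤ m → LinearIndepOn F h (S : Set ι)

theorem InGeneralPosition.eq_zero (hh : InGeneralPosition h) {c : ι → F}
    (hc : c ∈ codeOfColumns h) (hm : (supp c).card ≤ m) : c = 0 := by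
  rw [codeOfColumns_eq_ker, LinearMap.mem_ker, linearCombination_eq_sum subset_rfl] at hc
  funext j
  by_contra hj
  exact hj ((linearIndepOn_finset_iff.1 (hh _ hm)) c hc j (mem_supp.2 hj))

theorem InGeneralPosition.finrank (hh : InGeneralPosition h) (hm : m ≤ Fintype.card ι) :
    Module.finrank F (codeOfColumns h) = Fintype.card ι - m := by
  have hr : LinearMap.range (Fintype.linearCombination F h) = ⊤ := by
    obtain ⟨S, -, hS⟩ := Finset.exists_subset_card_eq (s := (Finset.univ : Finset ι)) hm
    rw [Fintype.range_linearCombination]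
    apply Submodule.eq_top_of_finrank_eq
    refine le_antisymm (Submodule.finrank_le _) ?_
    have h1 : Module.finrank F (Submodule.span F (h '' (S : Set ι))) = m := by
      rw [Set.image_eq_range]
      exact (finrank_span_eq_card (hh S hS.le)).trans ((Fintype.card_coe S).trans hS)
    rw [Module.finrank_fin_fun]
    refine h1.symm.le.trans ?_
    exact Submodule.finrank_mono (by
      rw [← Set.image_univ]; exact Submodule.span_mono (Set.image_mono (Set.subset_univ _)))
  have h2 := LinearMap.finrank_range_add_finrank_ker (Fintype.linearCombination F h)
  rw [hr, finrank_top, Module.finrank_fin_fun, Module.finrank_fintype_fun_eq_card,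
    ← codeOfColumns_eq_ker] at h2
  omega

/-- Any `m + 1` columns satisfy a linear relation, and all its coefficients are nonzero. -/
theorem InGeneralPosition.exists_codeword (hh : InGeneralPosition h) {S : Finset ι}
    (hS : S.card = m + 1) : ∃ w ∈ codeOfColumns h, supp w = S := by
  classical
  have hdep : ¬ LinearIndepOn F h (S : Set ι) := fun hi => by
    have := LinearIndependent.fintype_card_le_finrank hi
    rw [Module.finrank_fin_fun] at this
    simp only [Finset.coe_sort_coe, Fintype.card_coe] at this
    omega
  rw [linearIndepOn_finset_iff] at hdep
  push Not at hdep
  obtain ⟨f, hf, j, hj, hfj⟩ := hdep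
  have hsub : supp (fun j => if j ∈ S then f j else 0) ⊆ S := fun j hj => by
    by_contra hn
    exact mem_supp.1 hj (if_neg hn)
  have hmem : (fun j => if j ∈ S then f j else 0) ∈ codeOfColumns h := by
    rw [codeOfColumns_eq_ker, LinearMap.mem_ker, linearCombination_eq_sum hsub, ← hf]
    exact Finset.sum_congr rfl fun j hj => by rw [if_pos hj]
  refine ⟨_, hmem, Finset.eq_of_subset_of_card_le hsub (hS.trans_le ?_)⟩
  by_contra! hlt
  have h0 := congrFun (hh.eq_zero hmem (by omega)) j
  simp only [if_pos hj, Pi.zero_apply] at h0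
  exact hfj h0

theorem InGeneralPosition.hasMinDist (hh : InGeneralPosition h) (hm : m + 1 ≤ Fintype.card ι) :
    HasMinDist (codeOfColumns h) (m + 1) := by
  classical
  constructor
  · obtain ⟨S, -, hS⟩ := Finset.exists_subset_card_eq (s := (Finset.univ : Finset ι)) hm
    obtain ⟨w, hw, rfl⟩ := hh.exists_codeword hS
    refine ⟨w, hw, 0, Submodule.zero_mem _, ?_, ?_⟩
    · rintro rfl
      simp [supp] at hS
    · rw [hammingDist_zero_right, hammingNorm_eq_card_supp, hS]
  · rintro _ ⟨c, hc, c', hc', hne, rfl⟩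
    rw [hammingDist_eq_card_supp]
    by_contra! hlt
    exact hne (sub_eq_zero.1 (hh.eq_zero (Submodule.sub_mem _ hc hc') (by omega)))

/-- The number of codewords of minimum weight of an MDS code: they are the nonzero multiples of one
codeword for each set of `m + 1` positions. -/
theorem InGeneralPosition.weightCount_eq [Fintype F] (hh : InGeneralPosition h) :
    weightCount (codeOfColumns h) (m + 1) =
      (Fintype.card ι).choose (m + 1) * (Fintype.card F - 1) := by
  classical
  have hset : {c : ι → F | c ∈ codeOfColumns h ∧ hammingNorm c = m + 1} =
      ↑(Finset.univ.filter fun c : ι → F => c ∈ codeOfColumns h ∧ (supp c).card = m + 1) := by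
    ext c
    simp [hammingNorm_eq_card_supp]
  have hw : weightCount (codeOfColumns h) (m + 1) =
      (Finset.univ.filter fun c : ι → F => c ∈ codeOfColumns h ∧ (supp c).card = m + 1).card := by
    rw [← Set.ncard_coe_finset, ← hset]
    simp only [weightCount]
  rw [hw, Finset.card_eq_sum_card_fiberwise (f := supp) (t := Finset.powersetCard (m + 1) Finset.univ)
    (fun c hc => by simpa using (Finset.mem_filter.1 hc).2.2)]
  rw [Finset.sum_const_nat (m := Fintype.card F - 1), Finset.card_powersetCard, Finset.card_univ]
  intro S hS
  have hS := (Finset.mem_powersetCard.1 hS).2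
  obtain ⟨w, hwC, rfl⟩ := hh.exists_codeword hS
  obtain ⟨j, hj⟩ : (supp w).Nonempty := Finset.card_pos.1 (by omega)
  have hwj := mem_supp.1 hj
  rw [← Finset.card_univ, ← Finset.card_erase_of_mem (Finset.mem_univ (0 : F))]
  symm
  refine Finset.card_bij (fun b _ => b • w) (fun b hb => ?_) (fun b _ b' _ hbb => ?_) fun c hc => ?_
  · have hb : b ≠ 0 := (Finset.mem_erase.1 hb).1
    have : supp (b • w) = supp w := by ext i; simp [mem_supp, hb]
    simp only [Finset.mem_filter, Finset.mem_univ, true_and, this, hS, and_true]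
    exact Submodule.smul_mem _ _ hwC
  · exact mul_right_cancel₀ hwj (congrFun hbb j)
  · simp only [Finset.mem_filter, Finset.mem_univ, true_and] at hc
    obtain ⟨⟨hcC, -⟩, hcw⟩ := hc
    have hcj : c j ≠ 0 := mem_supp.1 (hcw ▸ hj)
    refine ⟨c j / w j, by simpa using div_ne_zero hcj hwj, ?_⟩
    -- subtracting a multiple of `w` clears the position `j`, leaving weight at most `m`
    have hsub : supp (c - (c j / w j) • w) ⊆ (supp w).erase j := fun i hi => by
      have hi := mem_supp.1 hi
      refine Finset.mem_erase.2 ⟨?_, mem_supp.2 fun hwi => ?_⟩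
      · rintro rfl
        simp [hwj] at hi
      · have hci : c i = 0 := not_ne_iff.1 (mt mem_supp.2 (by rw [hcw, mem_supp]; simpa using hwi))
        simp [hwi, hci] at hi
    have h0 := hh.eq_zero (Submodule.sub_mem _ hcC (Submodule.smul_mem _ (c j / w j) hwC))
      ((Finset.card_le_card hsub).trans (by rw [Finset.card_erase_of_mem hj]; omega))
    exact (sub_eq_zero.1 h0).symm

end GeneralCodes

/-! ### The codes associated with the twisted cubic -/

section CubicCodes

variable {F ι : Type*} [Field F] {v : ι → F} {e : ι ≃ OnePoint F}

theorem span_smul_image {M : Type*} [AddCommGroup M] [Module F M] (hv : ∀ j, v j ≠ 0) (w : ι → M)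
    (S : Set ι) :
    Submodule.span F ((fun j => v j • w j) '' S) = Submodule.span F (w '' S) := by
  apply le_antisymm <;> rw [Submodule.span_le] <;> rintro _ ⟨j, hj, rfl⟩
  · exact Submodule.smul_mem _ _ (Submodule.subset_span ⟨j, hj, rfl⟩)
  · rw [← inv_smul_smul₀ (hv j) (w j)]
    exact Submodule.smul_mem _ _ (Submodule.subset_span ⟨j, hj, rfl⟩)

theorem span_columns (hv : ∀ j, v j ≠ 0) (e : ι ≃ OnePoint F) (S : Finset ι) :
    Submodule.span F ((fun j => v j • cubicVec (e j)) '' (S : Set ι)) =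
      Submodule.span F (cubicVec '' ((S.map e.toEmbedding : Finset _) : Set (OnePoint F))) := by
  rw [span_smul_image hv, Finset.coe_map, Set.image_image]
  rfl

theorem cubicVec_rev (t : OnePoint F) (i : Fin 4) :
    cubicVec t i.rev = rsColumn 4 t i := by
  induction t using OnePoint.rec <;> fin_cases i <;> simp [cubicVec, rsColumn, Fin.rev]

/-- Reversing the order of the rows of the parity-check matrix turns the points of the cubic into
Reed–Solomon columns. -/
theorem isGDRS_columns [Fintype ι] (hv : ∀ j, v j ≠ 0) (e : ι ≃ OnePoint F) :
    IsGDRS 4 (codeOfColumns fun j => v j • cubicVec (e j)) := by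
  refine ⟨e, v, hv, ?_⟩
  ext x
  simp only [codeOfColumns_eq_ker, LinearMap.mem_ker, Fintype.linearCombination_apply, funext_iff,
    Finset.sum_apply, Pi.smul_apply, Pi.zero_apply, ← cubicVec_rev]
  exact ⟨fun h i => h i.rev, fun h i => by simpa using h i.rev⟩

variable [Fintype F]

theorem inGeneralPosition_columns (hq : 3 ≤ Fintype.card F) (hv : ∀ j, v j ≠ 0)
    (e : ι ≃ OnePoint F) : InGeneralPosition fun j => v j • cubicVec (e j) := by
  intro S hS
  have h1 : LinearIndepOn F (cubicVec ∘ e) (S : Set ι) := by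
    refine LinearIndepOn.comp_of_image ?_ e.injective.injOn
    have := linearIndepOn_cubicVec hq (T := S.map e.toEmbedding) (by rwa [Finset.card_map])
    rwa [Finset.coe_map] at this
  exact LinearIndependent.units_smul h1 fun j => Units.mk0 (v j) (hv j)

variable [Fintype ι]

theorem isAssociatedCode_iff (hq : 3 ≤ Fintype.card F) {C : Submodule F (ι → F)} :
    IsAssociatedCode C (twistedCubic F) ↔ ∃ (e : ι ≃ OnePoint F) (v : ι → F), (∀ j, v j ≠ 0) ∧
      C = codeOfColumns fun j => v j • cubicVec (e j) := by
  constructor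
  · rintro ⟨h, h0, hbij, rfl⟩
    have hmem (j) : ∃ t, cubicPoint t = Projectivization.mk F (h j) (h0 j) :=
      hbij.mapsTo (Set.mem_univ j)
    choose e he using hmem
    have hinj : Function.Injective e := fun i j hij => hbij.injOn (Set.mem_univ i) (Set.mem_univ j)
      ((he i).symm.trans ((congrArg cubicPoint hij).trans (he j)))
    have hsurj : Function.Surjective e := fun t => by
      obtain ⟨j, -, hj⟩ := hbij.surjOn ⟨t, rfl⟩
      exact ⟨j, cubicPoint_injective hq ((he j).trans hj)⟩
    have hv (j) : ∃ c : F, c • cubicVec (e j) = h j :=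
      (Projectivization.mk_eq_mk_iff' F _ _ _ _).1 (he j).symm
    choose v hv using hv
    refine ⟨Equiv.ofBijective e ⟨hinj, hsurj⟩, v, fun j hj => h0 j ?_, ?_⟩
    · rw [← hv, hj, zero_smul]
    · exact congrArg codeOfColumns (funext fun j => (hv j).symm)
  · rintro ⟨e, v, hv, rfl⟩
    have h0 (j) : v j • cubicVec (e j) ≠ 0 := smul_ne_zero (hv j) (cubicVec_ne_zero _)
    have hmk (j) : Projectivization.mk F (v j • cubicVec (e j)) (h0 j) = cubicPoint (e j) :=
      (Projectivization.mk_eq_mk_iff' F _ _ _ _).2 ⟨v j, rfl⟩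
    refine ⟨_, h0, ?_, rfl⟩
    simp only [hmk]
    refine ⟨fun j _ => ⟨e j, rfl⟩, fun i _ j _ hij => e.injective (cubicPoint_injective hq hij), ?_⟩
    rintro _ ⟨t, rfl⟩
    exact ⟨e.symm t, Set.mem_univ _, by simp only [Equiv.apply_symm_apply]; rfl⟩

theorem distToCode_le_two_iff (hq : 3 ≤ Fintype.card F) (hv : ∀ j, v j ≠ 0) (e : ι ≃ OnePoint F)
    (x : ι → F) : distToCode x (codeOfColumns fun j => v j • cubicVec (e j)) ≤ 2 ↔
      ¬ OffChords (Fintype.linearCombination F (fun j => v j • cubicVec (e j)) x) := by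
  classical
  simp only [distToCode_le_iff_mem_span, span_columns hv e, OffChords, not_forall, not_not]
  constructor
  · rintro ⟨S, hS, hx⟩
    obtain ⟨T, hST, -, hT⟩ := Finset.exists_subsuperset_card_eq (n := 2)
      (Finset.subset_univ (S.map e.toEmbedding)) (by rwa [Finset.card_map])
      (by rw [Finset.card_univ, card_onePoint F]; omega)
    obtain ⟨s, t, -, rfl⟩ := Finset.card_eq_two.1 hT
    exact ⟨s, t, Submodule.span_mono (Set.image_mono (by simpa using Finset.coe_subset.2 hST)) hx⟩
  · rintro ⟨s, t, hx⟩
    exact ⟨{e.symm s, e.symm t}, Finset.card_le_two, by simpa [Set.image_pair] using hx⟩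

theorem distToCode_le_three (hq : 5 ≤ Fintype.card F) (hv : ∀ j, v j ≠ 0) (e : ι ≃ OnePoint F)
    (x : ι → F) : distToCode x (codeOfColumns fun j => v j • cubicVec (e j)) ≤ 3 := by
  classical
  by_cases hx : OffChords (Fintype.linearCombination F (fun j => v j • cubicVec (e j)) x)
  · obtain ⟨T, hT⟩ : (planesThrough
        (Fintype.linearCombination F (fun j => v j • cubicVec (e j)) x)).Nonempty :=
      Finset.card_pos.1 ((mu_pos hq).trans_le (mu_le_card_planesThrough (by omega) hx))
    simp only [planesThrough, Finset.mem_filter, Finset.mem_powersetCard, Finset.subset_univ,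
      true_and] at hT
    refine distToCode_le_iff_mem_span.2 ⟨T.map e.symm.toEmbedding, ?_, ?_⟩
    · rw [Finset.card_map, hT.1]
    · rw [span_columns hv e]
      simpa [Finset.map_map] using hT.2
  · exact ((distToCode_le_two_iff (by omega) hv e x).2 hx).trans (by norm_num)

theorem distToCode_eq_three_iff (hq : 5 ≤ Fintype.card F) (hv : ∀ j, v j ≠ 0) (e : ι ≃ OnePoint F)
    (x : ι → F) : distToCode x (codeOfColumns fun j => v j • cubicVec (e j)) = 3 ↔
      OffChords (Fintype.linearCombination F (fun j => v j • cubicVec (e j)) x) := by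
  rw [← not_iff_not, ← distToCode_le_two_iff (by omega) hv e x]
  have := distToCode_le_three hq hv e x
  omega

theorem hasCoveringRadius_columns (hq : 5 ≤ Fintype.card F) (hv : ∀ j, v j ≠ 0)
    (e : ι ≃ OnePoint F) :
    HasCoveringRadius (codeOfColumns fun j => v j • cubicVec (e j)) 3 := by
  constructor
  · have hx : (![0, 1, 0, 0] : Fin 4 → F) ∈ Submodule.span F
        ((fun j => v j • cubicVec (e j)) '' ((Finset.univ : Finset ι) : Set ι)) := by
      obtain ⟨U, -, hU⟩ := Finset.exists_subset_card_eq
        (s := (Finset.univ : Finset (OnePoint F))) (n := 4)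
        (by rw [Finset.card_univ, card_onePoint F]; omega)
      rw [span_columns hv e]
      have htop : (![0, 1, 0, 0] : Fin 4 → F) ∈
          Submodule.span F (cubicVec '' (U : Set (OnePoint F))) := by
        rw [span_cubicVec_eq_top (by omega) hU]; trivial
      exact Submodule.span_mono (Set.image_mono (by simp)) htop
    obtain ⟨x, -, hx⟩ := mem_span_columns_iff.1 hx
    exact ⟨x, (distToCode_eq_three_iff hq hv e x).2 (hx ▸ offChords_tangent_point)⟩
  · rintro _ ⟨x, rfl⟩
    exact distToCode_le_three hq hv e x

/-- Each plane through the syndrome of a vector at distance three gives an error vector of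
weight three, supported exactly at the three points generating the plane. -/
theorem isMCF_columns (hq : 5 ≤ Fintype.card F) (hv : ∀ j, v j ≠ 0) (e : ι ≃ OnePoint F) :
    IsMCF (codeOfColumns fun j => v j • cubicVec (e j)) 3 (mu (Fintype.card F)) := by
  classical
  refine ⟨hasCoveringRadius_columns hq hv e, fun x hx => ?_⟩
  have hoff := (distToCode_eq_three_iff hq hv e x).1 hx
  set h : ι → Fin 4 → F := fun j => v j • cubicVec (e j) with hh
  have herr : ∀ T ∈ planesThrough (Fintype.linearCombination F h x), ∃ c : ι → F,
      supp c = T.map e.symm.toEmbedding ∧ (supp c).card = 3 ∧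
      Fintype.linearCombination F h c = Fintype.linearCombination F h x := by
    intro T hT
    simp only [planesThrough, Finset.mem_filter, Finset.mem_powersetCard, Finset.subset_univ,
      true_and] at hT
    have hmem : Fintype.linearCombination F h x ∈
        Submodule.span F (h '' ((T.map e.symm.toEmbedding : Finset ι) : Set ι)) := by
      rw [hh, span_columns hv e]
      simpa [Finset.map_map] using hT.2
    obtain ⟨c, hcT, hc⟩ := mem_span_columns_iff.1 hmem
    have h3 : 3 ≤ (supp c).card := by
      by_contra! hlt
      have h2 : distToCode x (codeOfColumns h) ≤ 2 :=
        distToCode_le_iff.2 ⟨c, Nat.lt_succ_iff.1 hlt, hc⟩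
      omega
    have hTc : (T.map e.symm.toEmbedding).card = 3 := by rw [Finset.card_map, hT.1]
    have hs := Finset.eq_of_subset_of_card_le hcT (hTc.trans_le h3)
    exact ⟨c, hs, by rw [hs, hTc], hc⟩
  choose! err herr using herr
  refine (mu_le_card_planesThrough (by omega) hoff).trans ?_
  rw [← Set.ncard_coe_finset]
  refine Set.ncard_le_ncard_of_injOn (fun T => x - err T) (fun T hT => ⟨?_, ?_⟩)
    (fun T hT T' hT' hTT => ?_) (Set.toFinite _)
  · rw [codeOfColumns_eq_ker, LinearMap.mem_ker, map_sub, (herr T hT).2.2, sub_self]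
  · exact (hammingDist_sub_right_eq x _).trans (herr T hT).2.1
  · have h1 : err T = err T' := sub_right_injective hTT
    have h2 := (herr T hT).1
    rw [h1, (herr T' hT').1] at h2
    exact (Finset.map_injective _ h2).symm

/-! ### The density -/

theorem six_mul_mu_le {q : ℕ} (hq : 3 ≤ q) : 6 * (mu q : ℝ) ≤ (q : ℝ) ^ 2 - 3 * q + 2 := by
  have h : 6 * mu q + 3 * q ≤ q ^ 2 + 2 := by
    by_cases hd : 3 ∣ q
    · have := six_mul_mu_of_dvd hq hd; omega
    · exact (six_mul_mu_of_not_dvd hq hd).le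
  have h' : (6 * mu q + 3 * q : ℝ) ≤ q ^ 2 + 2 := by exact_mod_cast h
  linarith

theorem le_six_mul_mu {q : ℕ} (hq : 3 ≤ q) : (q : ℝ) ^ 2 - 3 * q ≤ 6 * (mu q : ℝ) := by
  have h : q ^ 2 ≤ 6 * mu q + 3 * q := by
    by_cases hd : 3 ∣ q
    · exact (six_mul_mu_of_dvd hq hd).ge
    · have := six_mul_mu_of_not_dvd hq hd; omega
  have h' : (q ^ 2 : ℝ) ≤ 6 * mu q + 3 * q := by exact_mod_cast h
  linarith

theorem cast_mu {q : ℕ} (hq : 3 ≤ q) : (mu q : ℚ) =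
    if 3 ∣ q then ((q : ℚ) ^ 2 - 3 * q) / 6 else ((q : ℚ) ^ 2 - 3 * q + 2) / 6 := by
  split_ifs with hd
  · have h : (6 * mu q + 3 * q : ℚ) = q ^ 2 := by exact_mod_cast six_mul_mu_of_dvd hq hd
    linarith
  · have h : (6 * mu q + 3 * q : ℚ) = q ^ 2 + 2 := by exact_mod_cast six_mul_mu_of_not_dvd hq hd
    linarith

theorem muDensity_columns (hq : 5 ≤ Fintype.card F) (hv : ∀ j, v j ≠ 0) (e : ι ≃ OnePoint F) :
    muDensity (codeOfColumns fun j => v j • cubicVec (e j)) 3 (mu (Fintype.card F)) =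
      ((Fintype.card F : ℝ) - 1) * ((Fintype.card F : ℝ) ^ 2 + Fintype.card F - 4) /
        (6 * mu (Fintype.card F) * ((Fintype.card F : ℝ) + 1)) := by
  have hgp := inGeneralPosition_columns (by omega) hv e
  have hw := hgp.weightCount_eq
  have hfr := hgp.finrank (by rw [card_of_equiv_onePoint e]; omega)
  have hmu := mu_pos hq
  rw [card_of_equiv_onePoint e] at hw hfr
  unfold muDensity
  simp only [Nat.reduceMul, Nat.reduceSub, card_of_equiv_onePoint e, hfr]
  rw [hw]
  generalize mu (Fintype.card F) = μ at *
  obtain ⟨k, hk⟩ : ∃ k, Fintype.card F = k + 5 := ⟨Fintype.card F - 5, by omega⟩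
  rw [hk, show k + 5 + 1 - (k + 5 + 1 - 4) = 4 by omega, show k + 5 - 1 = k + 4 by omega]
  have hμ : (0 : ℝ) < μ := by exact_mod_cast hmu
  have h3 : ((k + 5 + 1).choose 3 : ℝ) = (k + 6) * (k + 5) * (k + 4) / 6 := by
    have h := Nat.descFactorial_eq_factorial_mul_choose (k + 5 + 1) 3
    simp only [Nat.descFactorial, Nat.factorial] at h
    rw [eq_div_iff (by norm_num)]
    have h' : (k + 5 + 1).choose 3 * 6 = (k + 6) * (k + 5) * (k + 4) := by
      rw [mul_comm, ← show _ = 6 * _ from h]; simp; ring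
    exact_mod_cast h'
  have h5 : ((k + 5 + 1).choose 5 : ℝ) =
      (k + 6) * (k + 5) * (k + 4) * (k + 3) * (k + 2) / 120 := by
    have h := Nat.descFactorial_eq_factorial_mul_choose (k + 5 + 1) 5
    simp only [Nat.descFactorial, Nat.factorial] at h
    rw [eq_div_iff (by norm_num)]
    have h' : (k + 5 + 1).choose 5 * 120 = (k + 6) * (k + 5) * (k + 4) * (k + 3) * (k + 2) := by
      rw [mul_comm, ← show _ = 120 * _ from h]; simp; ring
    exact_mod_cast h'
  have h2 : ((k + 5 + 1).choose 2 : ℝ) = (k + 6) * (k + 5) / 2 := by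
    rw [Nat.cast_choose_two]; push_cast; ring
  have h52 : (Nat.choose 5 2 : ℝ) = 10 := by norm_num [Nat.choose]
  simp only [Finset.sum_range_succ, Finset.sum_range_zero, Nat.choose_zero_right,
    Nat.choose_one_right, Nat.reduceAdd]
  push_cast [h2, h3, h5, h52]
  have hk0 : (0 : ℝ) ≤ k := Nat.cast_nonneg k
  -- the number of syndromes off the chords, in closed form
  have hden : ((k : ℝ) + 5) ^ 4 - (0 + 1 * ((k : ℝ) + 5 - 1) ^ 0 +
      ((k : ℝ) + 5 + 1) * ((k : ℝ) + 5 - 1) ^ 1 +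
      ((k : ℝ) + 6) * (k + 5) / 2 * ((k : ℝ) + 5 - 1) ^ 2) =
      (k + 5) * (k + 4) * (k + 6) ^ 2 / 2 := by ring
  rw [hden]
  rw [div_eq_div_iff (by positivity) (by positivity)]
  ring

theorem one_lt_muDensity_columns (hq : 5 ≤ Fintype.card F) (hv : ∀ j, v j ≠ 0)
    (e : ι ≃ OnePoint F) :
    1 < muDensity (codeOfColumns fun j => v j • cubicVec (e j)) 3 (mu (Fintype.card F)) := by
  rw [muDensity_columns hq hv e]
  have hpos : (0 : ℝ) < mu (Fintype.card F) := by exact_mod_cast mu_pos hq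
  have hle := six_mul_mu_le (q := Fintype.card F) (by omega)
  have hq' : (5 : ℝ) ≤ Fintype.card F := by exact_mod_cast hq
  generalize (mu (Fintype.card F) : ℝ) = μ at *
  generalize (Fintype.card F : ℝ) = q at *
  rw [one_lt_div (by positivity)]
  calc 6 * μ * (q + 1) ≤ (q ^ 2 - 3 * q + 2) * (q + 1) := by gcongr
    _ < (q - 1) * (q ^ 2 + q - 4) := by nlinarith

theorem muDensity_columns_le (hq : 5 ≤ Fintype.card F) (hv : ∀ j, v j ≠ 0) (e : ι ≃ OnePoint F) :
    muDensity (codeOfColumns fun j => v j • cubicVec (e j)) 3 (mu (Fintype.card F)) ≤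
      1 + 7 / (Fintype.card F : ℝ) := by
  rw [muDensity_columns hq hv e]
  have hpos : (0 : ℝ) < mu (Fintype.card F) := by exact_mod_cast mu_pos hq
  have hle := le_six_mul_mu (q := Fintype.card F) (by omega)
  have hq' : (5 : ℝ) ≤ Fintype.card F := by exact_mod_cast hq
  generalize (mu (Fintype.card F) : ℝ) = μ at *
  generalize (Fintype.card F : ℝ) = q at *
  have h0 : 0 < q := by linarith
  rw [div_le_iff₀ (by positivity)]
  calc (q - 1) * (q ^ 2 + q - 4) ≤ (1 + 7 / q) * ((q ^ 2 - 3 * q) * (q + 1)) := by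
        have h1 : (1 + 7 / q) * ((q ^ 2 - 3 * q) * (q + 1)) = (q + 7) * (q - 3) * (q + 1) := by
          field_simp
        rw [h1]; nlinarith
    _ ≤ (1 + 7 / q) * (6 * μ * (q + 1)) := by gcongr

end CubicCodes

end TwistedCubicCode

theorem theorem3p2 :
    (∀ (F : Type*) [Field F] [Fintype F] (q : ℕ), Fintype.card F = q → 5 ≤ q →
      -- the value of `μ`, with exact division
      (TwistedCubicCode.mu q : ℚ) =
        (if 3 ∣ q then ((q : ℚ) ^ 2 - 3 * q) / 6 else ((q : ℚ) ^ 2 - 3 * q + 2) / 6) ∧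
      -- the twisted cubic is a minimal `(2, μ)`-saturating `(q + 1)`-set
      (TwistedCubicCode.twistedCubic F).ncard = q + 1 ∧
      TwistedCubicCode.IsMinimalSaturating 2 (TwistedCubicCode.mu q)
        (TwistedCubicCode.twistedCubic F) ∧
      -- the associated codes
      (∃ C : Submodule F (Fin (q + 1) → F),
        TwistedCubicCode.IsAssociatedCode C (TwistedCubicCode.twistedCubic F)) ∧
      (∀ C : Submodule F (Fin (q + 1) → F),
        TwistedCubicCode.IsAssociatedCode C (TwistedCubicCode.twistedCubic F) →
        TwistedCubicCode.IsGDRS 4 C ∧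
        TwistedCubicCode.HasParameters C (q + 1) (q - 3) 5 3 ∧
        TwistedCubicCode.IsQuasiPerfect C ∧
        TwistedCubicCode.IsMCF C 3 (TwistedCubicCode.mu q) ∧
        1 < TwistedCubicCode.muDensity C 3 (TwistedCubicCode.mu q))) ∧
    -- the density tends to `1` as `q → ∞`
    (∀ (F : ℕ → Type*) [∀ i, Field (F i)] [∀ i, Fintype (F i)] (q : ℕ → ℕ),
      (∀ i, Fintype.card (F i) = q i) → (∀ i, 5 ≤ q i) → Tendsto q atTop atTop →
      ∀ C : ∀ i, Submodule (F i) (Fin (q i + 1) → F i),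
        (∀ i, TwistedCubicCode.IsAssociatedCode (C i) (TwistedCubicCode.twistedCubic (F i))) →
        TwistedCubicCode.IsAsymptoticallyOptimalMCF C 3 (fun i => TwistedCubicCode.mu (q i))) := by
  refine ⟨fun F _ _ q hF hq => ?_, fun F _ _ q hF hq hlim C hC => ?_⟩
  · subst hF
    have hq3 : 3 ≤ Fintype.card F := by omega
    refine ⟨TwistedCubicCode.cast_mu hq3, TwistedCubicCode.ncard_twistedCubic hq3,
      TwistedCubicCode.isMinimalSaturating_twistedCubic hq, ?_, fun C hC => ?_⟩
    · have e : Fin (Fintype.card F + 1) ≃ OnePoint F := Fintype.equivOfCardEq (by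
        rw [Fintype.card_fin, TwistedCubicCode.card_onePoint])
      exact ⟨_, (TwistedCubicCode.isAssociatedCode_iff hq3).2
        ⟨e, fun _ => 1, fun _ => one_ne_zero, rfl⟩⟩
    · obtain ⟨e, v, hv, rfl⟩ := (TwistedCubicCode.isAssociatedCode_iff hq3).1 hC
      have hgp := TwistedCubicCode.inGeneralPosition_columns hq3 hv e
      have hR := TwistedCubicCode.hasCoveringRadius_columns hq hv e
      have hd := hgp.hasMinDist (by rw [Fintype.card_fin]; omega)
      refine ⟨TwistedCubicCode.isGDRS_columns hv e, ⟨Fintype.card_fin _, ?_, hd, hR⟩,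
        ⟨5, 3, hd, hR, rfl⟩, TwistedCubicCode.isMCF_columns hq hv e,
        TwistedCubicCode.one_lt_muDensity_columns hq hv e⟩
      rw [hgp.finrank (by rw [Fintype.card_fin]; omega), Fintype.card_fin]
      omega
  · obtain rfl : (fun i => Fintype.card (F i)) = q := funext hF
    have hq3 (i) : 3 ≤ Fintype.card (F i) := le_trans (by norm_num) (hq i)
    have hcols (i) := (TwistedCubicCode.isAssociatedCode_iff (hq3 i)).1 (hC i)
    choose e v hv hCe using hcols
    obtain rfl : C = fun i => TwistedCubicCode.codeOfColumns
        fun j => v i j • TwistedCubicCode.cubicVec (e i j) := funext hCe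
    refine ⟨hlim, fun i => TwistedCubicCode.isMCF_columns (hq i) (hv i) (e i),
      tendsto_of_tendsto_of_tendsto_of_le_of_le tendsto_const_nhds ?_
        (fun i => (TwistedCubicCode.one_lt_muDensity_columns (hq i) (hv i) (e i)).le)
        fun i => TwistedCubicCode.muDensity_columns_le (hq i) (hv i) (e i)⟩
    have h0 := (tendsto_const_nhds (x := (7 : ℝ))).div_atTop
      (tendsto_natCast_atTop_atTop (R := ℝ) |>.comp hlim)
    simpa using h0.const_add 1
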